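/- Let $X=[-1,1]$ and let $\alpha,\beta>-1$ with $\gamma:=\max\{\alpha,\beta\}>-1/2$. Put $$c=\Big(\int_{-1}^1(1-x)^\alpha(1+x)^\beta\,dx\Big)^{-1},\qquad w(x)=c(1-x)^\alpha(1+x)^\beta,\qquad d\rho=w(x)\,dx \text{ on } X,\qquad \bar c=\frac{c\cdot 2^{\min\{\alpha,\beta\}}}{1+\gamma}.$$ Let $\mathbb P_m$ be the space of real univariate polynomials of degree at most $m$. For points $x_1,\dots,x_n$ put $$\|p\|=\Big(\int_X|p|^2\,d\rho\Big)^{1/2},\qquad \|p\|_{n,2}=\Big(\frac1n\sum_{i=1}^n|p(x_i)|^2\Big)^{1/2},\qquad D(n,m)=\sup_{p\in\mathbb P_m,\ \|p\|_{n,2}\neq0}\frac{\|p\|}{\|p\|_{n,2}}\in[0,\infty].$$ For every $\gamma>-1/2$ and every $C_0>0$ there are constants $\eta>0$ and $\nu>1$, depending only on $\gamma$ and $C_0$, such that for all $\alpha,\beta>-1$ with $\max\{\alpha,\beta\}=\gamma$ there is an $M\in\mathbb N$ with the following property. For every $C\ge C_0$ with $C>2e^2\bar c$, all integers $m,n$ with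 $M\le m<n$, and all random points $x_1,\dots,x_n$ that are independent and identically distributed with law $\rho$, one has, with probability at least $1-\frac{2e^2\bar c}{C}$, $$D(n,m)\ \ge\ \frac{\eta}{m^{1+\gamma}}\,\nu^{\lambda},\qquad \lambda=\Big(\frac{m^{2(1+\gamma)}}{Cn}\Big)^{\frac1{1+2\gamma}}.$$ In particular (taking $C_0=2e^2\bar c$), for fixed $\alpha,\beta$ the constants $\eta,\nu$ and the threshold $M$ can be chosen to serve all $C>2e^2\bar c$ at once. -/

import Mathlib

open MeasureTheory ProbabilityTheory Polynomial
open scoped ENNReal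

noncomputable section

/-- The normalizing constant `c = (∫_{-1}^{1} (1-x)^α (1+x)^β dx)⁻¹`. -/
def jacobiConst (α β : ℝ) : ℝ :=
  (∫ x in (-1 : ℝ)..1, (1 - x) ^ α * (1 + x) ^ β)⁻¹

/-- The Jacobi weight function `w(x) = c (1-x)^α (1+x)^β`. -/
def jacobiWeight (α β x : ℝ) : ℝ :=
  jacobiConst α β * ((1 - x) ^ α * (1 + x) ^ β)

/-- The sampling measure `dρ = w(x) dx` on `X = [-1,1]`, as a measure on `ℝ` carried by `X`. -/
def jacobiMeasure (α β : ℝ) : Measure ℝ :=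
  (volume.restrict (Set.Icc (-1 : ℝ) 1)).withDensity
    (fun x => ENNReal.ofReal (jacobiWeight α β x))

/-- The constant `c̄ = c · 2^{min{α,β}} / (1+γ)` with `γ = max{α,β}`. -/
def jacobiCbar (α β : ℝ) : ℝ :=
  jacobiConst α β * 2 ^ (min α β) / (1 + max α β)

/-- The `L²(X,ρ)` norm of a polynomial: `‖p‖ = (∫_X |p(x)|² dρ(x))^{1/2}`. -/
def polyL2Norm (α β : ℝ) (p : ℝ[X]) : ℝ :=
  Real.sqrt (∫ x, |p.eval x| ^ 2 ∂(jacobiMeasure α β))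

/-- The empirical semi-norm `‖p‖_{n,2} = ((1/n) ∑ i, |p(x i)|²)^{1/2}`. -/
def polyEmpNorm {n : ℕ} (x : Fin n → ℝ) (p : ℝ[X]) : ℝ :=
  Real.sqrt ((1 / (n : ℝ)) * ∑ i, |p.eval (x i)| ^ 2)

/-- `D(n,m) = sup { ‖p‖ / ‖p‖_{n,2} : p ∈ ℙ_m, ‖p‖_{n,2} ≠ 0 }`, a supremum in `[0,∞]`,
where `ℙ_m` is the space of real polynomials of degree at most `m`. -/
def Dnm (α β : ℝ) {n : ℕ} (m : ℕ) (x : Fin n → ℝ) : ℝ≥0∞ :=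
  ⨆ (p : ℝ[X]) (_ : p ∈ degreeLE ℝ (m : WithBot ℕ)) (_ : polyEmpNorm x p ≠ 0),
    ENNReal.ofReal (polyL2Norm α β p / polyEmpNorm x p)

/-- The exponent `λ = (m^{2(1+γ)} / (C n))^{1/(1+2γ)}`. -/
def rateExponent (γ C : ℝ) (n m : ℕ) : ℝ :=
  ((m : ℝ) ^ (2 * (1 + γ)) / (C * (n : ℝ))) ^ (1 / (1 + 2 * γ))

end

/-! ### Growth of Chebyshev polynomials beyond `1` -/

/-! By reflection assume `β ≤ α = γ`. Near `1` the measure is thin: `[1 - h, 1]` has mass at most `2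
c̄ h ^ (1 + γ)`. Take `u = κ λ` and `h = (120 u / m) ^ 2`. The exponent in `λ` is the one for which
the expected number of samples in `[1 - h, 1]`, divided by `u`, is `O(c̄ / C)`, so by Markov fewer
than `u` samples fall there with the required probability.

For such a sample, let `T` be a Chebyshev polynomial of degree `d` shifted by `h`, with `d ^ 2 * h`
of constant size: `|T| ≤ 1` on `[-1, 1 - h]`, while `T ≥ e ^ 2` on `[1 - h / 2, 1 - h / 4]`. With `K
= ⌊u⌋`, the polynomial `T ^ (14 K) * ∏ (T - T(x i))`, over the samples in `[1 - h, 1]`, vanishes at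
these samples and is at most `e ^ (24 K)` at the others. Its `L²` norm is at least `e ^ (27 K)` up
to a power of `m` (`exists_polynomial_small_on_sample_large_near_one`), so `D` is at least `e ^ u`
up to that power (`ofReal_exp_le_Dnm`).

The power of `m` is absorbed by lowering the rate to `e ^ (u / 5)`: if `e ^ (u / 5) ≤ m ^ (1 + γ)`
the claim follows from `D ≥ 1`, and otherwise `e ^ (4 u / 5) ≥ m ^ 2` pays for the loss. -/

/-- The recursion gives `U (k+2) - U (k+1) ≥ U (k+1) - U k` when `y ≥ 1`; the second conjunct
carries the induction. -/
lemma chebyshev_U_growth {y : ℝ} (hy : 1 ≤ y) (n : ℕ) :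
    (n : ℝ) + 1 ≤ (Chebyshev.U ℝ n).eval y ∧
      (Chebyshev.U ℝ n).eval y + 1 ≤ (Chebyshev.U ℝ (n + 1)).eval y := by
  induction n with
  | zero => simp; linarith
  | succ k ih =>
    obtain ⟨h1, h2⟩ := ih
    have h := congrArg (Polynomial.eval y) (Chebyshev.U_add_two ℝ (k : ℤ))
    simp only [eval_sub, eval_mul, eval_X, eval_ofNat] at h
    push_cast
    have e : (k : ℤ) + 1 + 1 = k + 2 := by ring
    rw [e, h]
    refine ⟨by linarith, ?_⟩
    have : (0 : ℝ) ≤ (Chebyshev.U ℝ (k + 1)).eval y := by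
      have : (0 : ℝ) ≤ k := k.cast_nonneg
      linarith
    nlinarith

lemma sq_mul_sub_le_chebyshev_T_sub (d : ℕ) {y z : ℝ} (hz : 1 ≤ z) (hzy : z ≤ y) :
    (d : ℝ) ^ 2 * (y - z) ≤ (Chebyshev.T ℝ d).eval y - (Chebyshev.T ℝ d).eval z := by
  refine (convex_Ici (1 : ℝ)).mul_sub_le_image_sub_of_le_deriv
    (f := fun x => (Chebyshev.T ℝ d).eval x) (by fun_prop) (by fun_prop) ?_ z hz y
    (hz.trans hzy) hzy
  intro x hx
  rw [interior_Ici] at hx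
  rw [Polynomial.deriv, Chebyshev.T_derivative_eq_U]
  rcases d with _ | k
  · simp
  · have := (chebyshev_U_growth hx.le k).1
    have e : ((k + 1 : ℕ) : ℤ) - 1 = k := by push_cast; ring
    rw [e]
    simp only [eval_mul, eval_intCast]
    push_cast
    nlinarith [(k.cast_nonneg : (0 : ℝ) ≤ k)]

lemma one_add_sq_div_two_le_cosh (t : ℝ) : 1 + t ^ 2 / 2 ≤ Real.cosh t := by
  have h := Real.cosh_two_mul (t / 2)
  have h2 := Real.cosh_sq (t / 2)
  have h3 : (t / 2) ^ 2 ≤ Real.sinh (t / 2) ^ 2 := by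
    rw [← sq_abs (t / 2), ← sq_abs (Real.sinh _), Real.abs_sinh]
    exact pow_le_pow_left₀ (abs_nonneg _) (Real.self_le_sinh_iff.2 (abs_nonneg _)) 2
  rw [show 2 * (t / 2) = t by ring] at h
  nlinarith

/-- Since `1 + h ≤ cosh √(2h)` and `T` increases on `[1, ∞)`, the identity `T_d (cosh t) = cosh (d
t)` applies. -/
lemma chebyshev_T_le_exp (d : ℕ) {h r : ℝ} (hh : 0 ≤ h) (hr : 0 ≤ r)
    (hd : (d : ℝ) ^ 2 * (2 * h) ≤ r ^ 2) :
    (Chebyshev.T ℝ d).eval (1 + h) ≤ Real.exp r := by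
  have h1 : 1 + h ≤ Real.cosh (Real.sqrt (2 * h)) := by
    have := one_add_sq_div_two_le_cosh (Real.sqrt (2 * h))
    rw [Real.sq_sqrt (by positivity)] at this
    linarith
  have h2 := sq_mul_sub_le_chebyshev_T_sub d (by linarith : 1 ≤ 1 + h) h1
  have h3 : 0 ≤ (d : ℝ) ^ 2 * (Real.cosh (Real.sqrt (2 * h)) - (1 + h)) :=
    mul_nonneg (sq_nonneg _) (by linarith)
  rw [Chebyshev.T_real_cosh] at h2
  have h4 : (d : ℝ) * Real.sqrt (2 * h) ≤ r := by
    refine le_of_sq_le_sq ?_ hr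
    rw [mul_pow, Real.sq_sqrt (by positivity)]
    exact hd
  have h5 : 0 ≤ (d : ℝ) * Real.sqrt (2 * h) := by positivity
  have h6 : Real.cosh ((d : ℝ) * Real.sqrt (2 * h)) ≤ Real.exp ((d : ℝ) * Real.sqrt (2 * h)) := by
    have := Real.sinh_nonneg_iff.2 h5
    rw [← Real.cosh_add_sinh]
    linarith
  have h7 := Real.exp_le_exp.2 h4
  push_cast at h2
  linarith

/-! ### A lower bound for the `L²` norm of a product of linear factors -/

/-- `u log u` is convex and lies above its tangent at `a`. -/
lemma mul_log_ge_tangent {u a : ℝ} (hu : 0 ≤ u) (ha : 0 < a) :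
    u * Real.log a + u - a ≤ u * Real.log u := by
  rcases hu.eq_or_lt with rfl | hu
  · simp [ha.le]
  · have h := Real.log_le_sub_one_of_pos (div_pos ha hu)
    rw [Real.log_div ha.ne' hu.ne'] at h
    have h2 := mul_le_mul_of_nonneg_left h hu.le
    have h3 : u * (a / u - 1) = a - u := by field_simp
    nlinarith

/-- `Real.log` is `log |·|`. The integral is smallest when `z` is the midpoint, as two tangents at
`(b - a) / 2` show. -/
lemma le_integral_log_sub {a b z : ℝ} (hab : a < b) (hz : z ∈ Set.Icc a b) :
    (b - a) * (Real.log ((b - a) / 2) - 1) ≤ ∫ x in a..b, Real.log (x - z) := by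
  rw [intervalIntegral.integral_comp_sub_right (fun x => Real.log x), integral_log]
  have h1 := mul_log_ge_tangent (u := b - z) (a := (b - a) / 2) (by linarith [hz.2]) (by linarith)
  have h2 := mul_log_ge_tangent (u := z - a) (a := (b - a) / 2) (by linarith [hz.1]) (by linarith)
  have h3 : Real.log (a - z) = Real.log (z - a) := by rw [← Real.log_neg_eq_log]; ring_nf
  rw [h3]
  nlinarith

/-- Jensen's inequality for `exp`: the product is `exp` of a sum of logarithms whose mean is at
least `A`. It is applied as the tangent bound `e ^ v ≥ e ^ A * (1 + v - A)`. -/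
lemma le_integral_prod_sq_of_mem {ι : Type*} (s : Finset ι) (z : ι → ℝ) {a b : ℝ} (hab : a < b)
    (hz : ∀ i ∈ s, z i ∈ Set.Icc a b) :
    (b - a) * ((b - a) / (2 * Real.exp 1)) ^ (2 * s.card) ≤
      ∫ x in a..b, ∏ i ∈ s, (x - z i) ^ 2 := by
  set L := Real.log ((b - a) / 2) - 1 with hL
  have hexpL : Real.exp L = (b - a) / (2 * Real.exp 1) := by
    rw [hL, Real.exp_sub, Real.exp_log (by linarith)]
    field_simp
  have hint : ∀ i ∈ s, IntervalIntegrable (fun x => Real.log (x - z i)) volume a b := by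
    intro i _
    simpa using (intervalIntegral.intervalIntegrable_log' (a := a - z i)
      (b := b - z i)).comp_sub_right (z i)
  have hsum : IntervalIntegrable (fun x => ∑ i ∈ s, Real.log (x - z i)) volume a b := by
    simpa only [Finset.sum_fn] using IntervalIntegrable.sum s hint
  set A := 2 * (s.card : ℝ) * L with hA
  have hexpA : Real.exp A = ((b - a) / (2 * Real.exp 1)) ^ (2 * s.card) := by
    rw [← hexpL, ← Real.exp_nat_mul, hA]; push_cast; ring_nf
  have hlog : (s.card : ℝ) * ((b - a) * L) ≤ ∫ x in a..b, ∑ i ∈ s, Real.log (x - z i) := by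
    rw [intervalIntegral.integral_finsetSum hint, ← nsmul_eq_mul]
    exact Finset.card_nsmul_le_sum _ _ _ fun i hi => le_integral_log_sub hab (hz i hi)
  -- At a zero of the product the convention `log 0 = 0` breaks the exponential formula, so these
  -- finitely many points are discarded.
  have hae : ∀ᵐ x : ℝ, x ∉ ((fun i => z i) '' (s : Set ι)) :=
    (((s.finite_toSet.image _).countable).ae_notMem volume)
  have hmono : ∫ x in a..b, Real.exp A * (1 - A + 2 * ∑ i ∈ s, Real.log (x - z i)) ≤
      ∫ x in a..b, ∏ i ∈ s, (x - z i) ^ 2 := by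
    refine intervalIntegral.integral_mono_ae hab.le ?_ ?_ ?_
    · exact ((intervalIntegrable_const).add (hsum.const_mul 2)).const_mul _
    · exact Continuous.intervalIntegrable (by fun_prop) _ _
    · filter_upwards [hae] with x hx
      have hne : ∀ i ∈ s, x - z i ≠ 0 := fun i hi h0 =>
        hx ⟨i, hi, by simp only; linarith⟩
      have h1 : ∏ i ∈ s, (x - z i) ^ 2 = Real.exp (2 * ∑ i ∈ s, Real.log (x - z i)) := by
        rw [Finset.mul_sum, Real.exp_sum]
        refine Finset.prod_congr rfl fun i hi => ?_
        rw [← Real.exp_log (show 0 < (x - z i) ^ 2 by have := hne i hi; positivity), Real.log_pow]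
        norm_num
      rw [h1]
      have h2 := Real.add_one_le_exp (2 * ∑ i ∈ s, Real.log (x - z i) - A)
      calc _ ≤ Real.exp A * Real.exp (2 * ∑ i ∈ s, Real.log (x - z i) - A) := by
            gcongr; linarith
        _ = _ := by rw [← Real.exp_add]; ring_nf
  refine le_trans ?_ hmono
  rw [intervalIntegral.integral_const_mul, intervalIntegral.integral_add intervalIntegrable_const
    (hsum.const_mul 2), intervalIntegral.integral_const_mul, intervalIntegral.integral_const,
    ← hexpA, smul_eq_mul, mul_comm]
  gcongr
  rw [hA]
  nlinarith

/-- Projecting each `z i` onto `[a, b]` only shrinks the factors. -/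
lemma le_integral_prod_sq {ι : Type*} (s : Finset ι) (z : ι → ℝ) {a b : ℝ} (hab : a < b) :
    (b - a) * ((b - a) / (2 * Real.exp 1)) ^ (2 * s.card) ≤
      ∫ x in a..b, ∏ i ∈ s, (x - z i) ^ 2 := by
  refine (le_integral_prod_sq_of_mem s (fun i => (Set.projIcc a b hab.le (z i) : ℝ)) hab
    fun i _ => (Set.projIcc a b hab.le (z i)).2).trans ?_
  refine intervalIntegral.integral_mono_on hab.le
    (Continuous.intervalIntegrable (by fun_prop) _ _)
    (Continuous.intervalIntegrable (by fun_prop) _ _) fun x hx => ?_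
  refine Finset.prod_le_prod (fun i _ => sq_nonneg _) fun i _ => ?_
  rw [Set.coe_projIcc, ← sq_abs, ← sq_abs (x - z i)]
  refine pow_le_pow_left₀ (abs_nonneg _) ?_ 2
  have h1 := hx.1
  have h2 := hx.2
  rcases max_cases a (min b (z i)) with h | h <;> rcases min_cases b (z i) with h' | h' <;>
    rcases abs_cases (x - z i) with h3 | h3 <;> rw [abs_le] <;> constructor <;> linarith

/-! ### Polynomials that are small at the sample points and large near `1` -/

/-- The Chebyshev polynomial of degree `d`, translated so that its growth starts at `1 - h`. -/
noncomputable def shiftedChebyshev (d : ℕ) (h : ℝ) : ℝ[X] :=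
  (Chebyshev.T ℝ d).comp (X + C h)

lemma shiftedChebyshev_eval (d : ℕ) (h x : ℝ) :
    (shiftedChebyshev d h).eval x = (Chebyshev.T ℝ d).eval (x + h) := by
  simp [shiftedChebyshev]

lemma natDegree_shiftedChebyshev_le (d : ℕ) (h : ℝ) : (shiftedChebyshev d h).natDegree ≤ d := by
  refine natDegree_comp_le.trans ?_
  simp

lemma sq_mul_abs_sub_le_shiftedChebyshev (d : ℕ) {h x z : ℝ} (hx : 1 - h ≤ x) (hz : 1 - h ≤ z) :
    (d : ℝ) ^ 2 * |x - z| ≤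
      |(shiftedChebyshev d h).eval x - (shiftedChebyshev d h).eval z| := by
  simp only [shiftedChebyshev_eval]
  rcases le_total z x with hzx | hzx
  · have := sq_mul_sub_le_chebyshev_T_sub d (y := x + h) (z := z + h) (by linarith) (by linarith)
    rw [abs_of_nonneg (sub_nonneg.2 hzx)]
    rw [show x + h - (z + h) = x - z by ring] at this
    exact this.trans (le_abs_self _)
  · have := sq_mul_sub_le_chebyshev_T_sub d (y := z + h) (z := x + h) (by linarith) (by linarith)
    rw [abs_sub_comm x, abs_of_nonneg (sub_nonneg.2 hzx), abs_sub_comm]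
    rw [show z + h - (x + h) = z - x by ring] at this
    exact this.trans (le_abs_self _)

lemma exists_polynomial_small_on_sample_large_near_one {n : ℕ} (x : Fin n → ℝ)
    (hx : ∀ i, x i ∈ Set.Icc (-1 : ℝ) 1) {h : ℝ} (h0 : 0 < h) (d K : ℕ)
    (hd : 16 ≤ (d : ℝ) ^ 2 * h) (hd' : (d : ℝ) ^ 2 * h ≤ 256)
    (hK : (Finset.univ.filter fun i => 1 - h ≤ x i).card ≤ K) :
    ∃ p : ℝ[X], p.natDegree ≤ 15 * K * d ∧
      (∀ i, |p.eval (x i)| ≤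
        Real.exp (24 * ((Finset.univ.filter fun i => 1 - h ≤ x i).card : ℝ))) ∧
      h / 4 * Real.exp (56 * K - 2 * ((Finset.univ.filter fun i => 1 - h ≤ x i).card : ℝ)) ≤
        ∫ y in (1 - h / 2)..(1 - h / 4), p.eval y ^ 2 := by
  set S := Finset.univ.filter fun i => 1 - h ≤ x i with hS
  set T := shiftedChebyshev d h with hT
  have hmemS : ∀ i, i ∈ S ↔ 1 - h ≤ x i := by simp [hS]
  refine ⟨T ^ (14 * K) * ∏ i ∈ S, (T - C (T.eval (x i))), ?_, ?_, ?_⟩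
  · have hTd := natDegree_shiftedChebyshev_le d h
    have h1 : (T ^ (14 * K)).natDegree ≤ 14 * K * d :=
      natDegree_pow_le.trans (Nat.mul_le_mul_left _ hTd)
    have h2 : (∏ i ∈ S, (T - C (T.eval (x i)))).natDegree ≤ K * d := by
      refine (natDegree_prod_le _ _).trans ?_
      refine (Finset.sum_le_card_nsmul S _ d fun i _ => ?_).trans ?_
      · exact (natDegree_sub_C).le.trans hTd
      · rw [smul_eq_mul]; exact Nat.mul_le_mul_right _ hK
    refine natDegree_mul_le.trans ?_
    linarith
  · intro j
    rw [eval_mul, eval_prod, eval_pow]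
    by_cases hj : j ∈ S
    · rw [Finset.prod_eq_zero hj (by simp), mul_zero, abs_zero]
      positivity
    · have hj1 : |T.eval (x j)| ≤ 1 := by
        rw [hT, shiftedChebyshev_eval]
        apply Chebyshev.abs_eval_T_real_le_one
        have := (hmemS j).not.1 hj
        rw [abs_le]
        constructor <;> linarith [(hx j).1]
      -- `d √(2h) ≤ √512 < 23`.
      have hti : ∀ i ∈ S, |T.eval (x i)| ≤ Real.exp 23 := by
        intro i hi
        have hi' := (hmemS i).1 hi
        rw [hT, shiftedChebyshev_eval]
        have h1 := Chebyshev.one_le_eval_T_real (d : ℤ) (x := x i + h) (by linarith)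
        rw [abs_of_nonneg (by linarith)]
        have h2 := sq_mul_sub_le_chebyshev_T_sub d (y := 1 + h) (z := x i + h) (by linarith)
          (by linarith [(hx i).2])
        have h3 : 0 ≤ (d : ℝ) ^ 2 * (1 + h - (x i + h)) :=
          mul_nonneg (sq_nonneg _) (by linarith [(hx i).2])
        have h4 := chebyshev_T_le_exp d h0.le (r := 23) (by norm_num) (by linarith)
        linarith
      have he : 1 + Real.exp 23 ≤ Real.exp 24 := by
        have h1 := Real.add_one_le_exp (1 : ℝ)
        have h2 : Real.exp 24 = Real.exp 23 * Real.exp 1 := by rw [← Real.exp_add]; norm_num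
        have h3 := Real.add_one_le_exp (23 : ℝ)
        nlinarith
      rw [abs_mul, abs_pow, Finset.abs_prod]
      calc _ ≤ 1 * ∏ i ∈ S, Real.exp 24 := by
            gcongr with i hi
            · exact pow_le_one₀ (abs_nonneg _) hj1
            · rw [eval_sub, eval_C]
              refine (abs_sub _ _).trans ?_
              linarith [hti i hi]
        _ = _ := by rw [Finset.prod_const, one_mul, ← Real.exp_nat_mul, mul_comm]
  · have hab : 1 - h / 2 < 1 - h / 4 := by linarith
    have hlow : ∫ y in (1 - h / 2)..(1 - h / 4),
        Real.exp (56 * K) * ((d : ℝ) ^ 2) ^ (2 * S.card) * ∏ i ∈ S, (y - x i) ^ 2 ≤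
        ∫ y in (1 - h / 2)..(1 - h / 4),
          (T ^ (14 * K) * ∏ i ∈ S, (T - C (T.eval (x i)))).eval y ^ 2 := by
      refine intervalIntegral.integral_mono_on hab.le
        (Continuous.intervalIntegrable (by fun_prop) _ _)
        (Continuous.intervalIntegrable (by fun_prop) _ _) fun y hy => ?_
      rw [eval_mul, eval_prod, eval_pow, mul_pow, ← Finset.prod_pow, mul_assoc]
      -- `T ≥ 1 + d ^ 2 * h / 2 ≥ 9 > e ^ 2`.
      have hTy : Real.exp 2 ≤ T.eval y := by
        rw [hT, shiftedChebyshev_eval]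
        have h1 := sq_mul_sub_le_chebyshev_T_sub d (y := y + h) (z := 1) le_rfl
          (by linarith [hy.1])
        have h2 : (d : ℝ) ^ 2 * (h / 2) ≤ (d : ℝ) ^ 2 * (y + h - 1) := by
          gcongr; linarith [hy.1]
        have h3 : Real.exp 2 = Real.exp 1 ^ 2 := by rw [← Real.exp_nat_mul]; norm_num
        have h4 := Real.exp_one_lt_d9
        have h5 := Real.exp_pos 1
        rw [Chebyshev.T_eval_one] at h1
        nlinarith
      gcongr ?_ * ?_
      · calc Real.exp (56 * K) = (Real.exp 2 ^ (14 * K)) ^ 2 := by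
              rw [← pow_mul, ← Real.exp_nat_mul]; push_cast; ring_nf
          _ ≤ _ := by gcongr
      · rw [mul_comm 2, mul_comm, pow_mul', ← Finset.prod_const,
          ← Finset.prod_mul_distrib]
        refine Finset.prod_le_prod (fun i _ => by positivity) fun i hi => ?_
        rw [← mul_pow, ← sq_abs, ← sq_abs (eval y _), abs_mul, mul_comm,
          abs_of_nonneg (sq_nonneg (d : ℝ)), eval_sub, eval_C]
        gcongr
        exact sq_mul_abs_sub_le_shiftedChebyshev d (by linarith [hy.1]) ((hmemS i).1 hi)
    refine le_trans ?_ hlow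
    rw [intervalIntegral.integral_const_mul]
    have hprod := le_integral_prod_sq S x hab
    have hL : 1 - h / 4 - (1 - h / 2) = h / 4 := by ring
    rw [hL] at hprod
    -- As `d ^ 2 * h / 8 ≥ 2`, each vanishing factor costs at most `e⁻¹` in geometric mean.
    calc _ = Real.exp (56 * K) * (h / 4 * (Real.exp (-1)) ^ (2 * S.card)) := by
          rw [← Real.exp_nat_mul, mul_left_comm, ← Real.exp_add]; push_cast; ring_nf
      _ ≤ Real.exp (56 * K) *
          (h / 4 * ((d : ℝ) ^ 2 * (h / 4 / (2 * Real.exp 1))) ^ (2 * S.card)) := by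
          gcongr
          rw [Real.exp_neg]
          have : (d : ℝ) ^ 2 * (h / 4 / (2 * Real.exp 1)) =
              ((d : ℝ) ^ 2 * h / 8) * (Real.exp 1)⁻¹ := by
            field_simp; ring
          rw [this]
          have h5 : 0 < (Real.exp 1)⁻¹ := by positivity
          nlinarith
      _ = Real.exp (56 * K) * ((d : ℝ) ^ 2) ^ (2 * S.card) *
          (h / 4 * (h / 4 / (2 * Real.exp 1)) ^ (2 * S.card)) := by rw [mul_pow]; ring
      _ ≤ _ := by gcongr

/-! ### The Jacobi measure -/

lemma measurable_jacobiWeight (α β : ℝ) : Measurable (jacobiWeight α β) := by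
  unfold jacobiWeight
  fun_prop

lemma jacobiConst_nonneg (α β : ℝ) : 0 ≤ jacobiConst α β := by
  unfold jacobiConst
  refine inv_nonneg.2 (intervalIntegral.integral_nonneg (by norm_num) fun x hx => ?_)
  exact mul_nonneg (Real.rpow_nonneg (by linarith [hx.2]) _)
    (Real.rpow_nonneg (by linarith [hx.1]) _)

/-- A vanishing constant would make the measure zero. -/
lemma jacobiConst_pos_of_isProbabilityMeasure {α β : ℝ}
    (hρ : IsProbabilityMeasure (jacobiMeasure α β)) : 0 < jacobiConst α β := by
  refine (jacobiConst_nonneg α β).lt_of_ne' fun h => ?_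
  have h1 : jacobiMeasure α β = 0 := by
    simp [jacobiMeasure, jacobiWeight, h]
  have h2 := hρ.measure_univ
  simp [h1] at h2

lemma ae_mem_Icc_jacobiMeasure (α β : ℝ) :
    ∀ᵐ x ∂(jacobiMeasure α β), x ∈ Set.Icc (-1 : ℝ) 1 :=
  (withDensity_absolutelyContinuous _ _).ae_le (ae_restrict_mem measurableSet_Icc)

lemma integrable_jacobiMeasure_of_continuous {α β : ℝ} [IsFiniteMeasure (jacobiMeasure α β)]
    {f : ℝ → ℝ} (hf : Continuous f) : Integrable f (jacobiMeasure α β) := by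
  obtain ⟨B, hB⟩ := (isCompact_Icc (a := (-1 : ℝ)) (b := 1)).exists_bound_of_continuousOn
    hf.continuousOn
  refine Integrable.of_bound hf.aestronglyMeasurable B ?_
  filter_upwards [ae_mem_Icc_jacobiMeasure α β] with x hx using hB x hx

lemma jacobiMeasure_Ici_le {α β h : ℝ} (hα : -1 < α) (hβ : -1 < β) (hβα : β ≤ α) (h0 : 0 < h)
    (h1 : h ≤ 1) :
    jacobiMeasure α β (Set.Ici (1 - h)) ≤
      ENNReal.ofReal (2 * jacobiCbar α β * h ^ (1 + α)) := by
  have hc := jacobiConst_nonneg α β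
  rw [jacobiMeasure, withDensity_apply _ measurableSet_Ici,
    Measure.restrict_restrict measurableSet_Ici]
  have hset : Set.Ici (1 - h) ∩ Set.Icc (-1) 1 = Set.Icc (1 - h) 1 := by
    ext x; simp only [Set.mem_inter_iff, Set.mem_Ici, Set.mem_Icc]
    constructor
    · rintro ⟨a, b, c⟩; exact ⟨a, c⟩
    · rintro ⟨a, c⟩; exact ⟨a, by linarith, c⟩
  rw [hset, ← restrict_Ioc_eq_restrict_Icc]
  have hint : IntervalIntegrable (fun x : ℝ => (1 - x) ^ α) volume (1 - h) 1 := by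
    have := (intervalIntegral.intervalIntegrable_rpow' (a := h) (b := 0) hα).comp_sub_left 1
    simpa using this
  have hint' : IntervalIntegrable (fun x : ℝ => jacobiConst α β * (2 * 2 ^ β) * (1 - x) ^ α)
      volume (1 - h) 1 := hint.const_mul _
  have hval : ∫ x in (1 - h)..1, jacobiConst α β * (2 * 2 ^ β) * (1 - x) ^ α =
      2 * jacobiCbar α β * h ^ (1 + α) := by
    rw [intervalIntegral.integral_const_mul,
      intervalIntegral.integral_comp_sub_left (fun x : ℝ => x ^ α), integral_rpow (Or.inl hα),
      jacobiCbar, min_eq_right hβα, max_eq_left hβα]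
    rw [sub_self, Real.zero_rpow (by linarith), sub_sub_cancel, add_comm α]
    ring
  rw [← hval, intervalIntegral.integral_of_le (by linarith),
    ofReal_integral_eq_lintegral_ofReal ((intervalIntegrable_iff_integrableOn_Ioc_of_le
      (by linarith)).1 hint') ?_]
  · refine setLIntegral_mono' measurableSet_Ioc fun x hx => ENNReal.ofReal_le_ofReal ?_
    rw [jacobiWeight, mul_assoc]
    refine mul_le_mul_of_nonneg_left ?_ hc
    rw [mul_comm]
    refine mul_le_mul_of_nonneg_right ?_ (Real.rpow_nonneg (by linarith [hx.2]) _)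
    -- `(1 + x) ^ β ≤ 2 * 2 ^ β` for either sign of `β`, using `β > -1` when it is negative.
    have hx1 : 1 ≤ 1 + x := by linarith [hx.1]
    have hx2 : 1 + x ≤ 2 := by linarith [hx.2]
    have h2pos : (0 : ℝ) < 2 ^ β := by positivity
    rcases le_total 0 β with hb | hb
    · have := Real.rpow_le_rpow (by linarith) hx2 hb
      linarith
    · have h3 : (1 + x) ^ β ≤ 1 := Real.rpow_le_one_of_one_le_of_nonpos hx1 hb
      have h4 : (2 : ℝ) ^ (-1 : ℝ) ≤ 2 ^ β := Real.rpow_le_rpow_of_exponent_le one_le_two hβ.le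
      rw [Real.rpow_neg_one] at h4
      linarith
  · refine (ae_restrict_iff' measurableSet_Ioc).2 (Filter.Eventually.of_forall fun x hx => ?_)
    have : 0 ≤ (1 - x) ^ α := Real.rpow_nonneg (by linarith [hx.2]) _
    positivity

/-- The window stays away from `1`, where the weight may vanish. The exponent `α + 1 > 0` treats
both signs of `α` at once; the extra factor `h / 4` is only a polynomial loss. -/
lemma jacobiWeight_ge {α β h x : ℝ} (hα : -1 < α) (hβ : -1 < β) (h0 : 0 < h)
    (h1 : h ≤ 1) (hx : x ∈ Set.Icc (1 - h / 2) (1 - h / 4)) :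
    jacobiConst α β / 2 * (h / 4) ^ (α + 1) ≤ jacobiWeight α β x := by
  have hc := jacobiConst_nonneg α β
  obtain ⟨hx1, hx2⟩ := hx
  rw [jacobiWeight, div_mul_eq_mul_div, mul_div_assoc]
  refine mul_le_mul_of_nonneg_left ?_ hc
  have ha : (h / 4) ^ (α + 1) ≤ (1 - x) ^ α :=
    (Real.rpow_le_rpow (by positivity) (by linarith) (by linarith)).trans
      (Real.rpow_le_rpow_of_exponent_ge (by linarith) (by linarith) (by linarith))
  have hb : (1 / 2 : ℝ) ≤ (1 + x) ^ β := by
    have h2 : (1 + x) ^ (-1 : ℝ) ≤ (1 + x) ^ β :=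
      Real.rpow_le_rpow_of_exponent_le (by linarith) hβ.le
    rw [Real.rpow_neg_one] at h2
    refine le_trans ?_ h2
    rw [one_div]
    exact inv_anti₀ (by linarith) (by linarith)
  have hp : 0 ≤ (h / 4) ^ (α + 1) := by positivity
  nlinarith

lemma const_mul_integral_le_integral_jacobiMeasure {α β h W : ℝ}
    [IsFiniteMeasure (jacobiMeasure α β)] (h0 : 0 < h) (h1 : h ≤ 1) (hW0 : 0 ≤ W)
    (hW : ∀ x ∈ Set.Icc (1 - h / 2) (1 - h / 4), W ≤ jacobiWeight α β x) {f : ℝ → ℝ}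
    (hf : Continuous f) (hf0 : ∀ x, 0 ≤ f x) :
    W * ∫ x in (1 - h / 2)..(1 - h / 4), f x ≤ ∫ x, f x ∂(jacobiMeasure α β) := by
  have hle : ENNReal.ofReal W • volume.restrict (Set.Icc (1 - h / 2) (1 - h / 4)) ≤
      jacobiMeasure α β := by
    refine Measure.le_iff.2 fun s hs => ?_
    rw [jacobiMeasure, withDensity_apply _ hs, Measure.restrict_restrict hs, Measure.smul_apply,
      Measure.restrict_apply hs, smul_eq_mul, ← setLIntegral_const]
    refine (setLIntegral_mono' (hs.inter measurableSet_Icc) fun x hx =>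
      ENNReal.ofReal_le_ofReal (hW x hx.2)).trans ?_
    refine lintegral_mono_set (Set.inter_subset_inter_right _ (Set.Icc_subset_Icc ?_ ?_)) <;>
      linarith
  have := integral_mono_measure hle (Filter.Eventually.of_forall hf0)
    (integrable_jacobiMeasure_of_continuous hf)
  rwa [integral_smul_measure, ENNReal.toReal_ofReal hW0, integral_Icc_eq_integral_Ioc,
    ← intervalIntegral.integral_of_le (by linarith), smul_eq_mul] at this

/-! ### Lower bounds for `Dnm` -/

lemma polyEmpNorm_le {n : ℕ} (hn : 0 < n) {x : Fin n → ℝ} {p : ℝ[X]} {A : ℝ} (hA : 0 ≤ A)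
    (h : ∀ i, |p.eval (x i)| ≤ A) : polyEmpNorm x p ≤ A := by
  have hn' : (0 : ℝ) < n := by exact_mod_cast hn
  refine Real.sqrt_le_iff.2 ⟨hA, ?_⟩
  have h1 : ∑ i, |p.eval (x i)| ^ 2 ≤ ∑ _i : Fin n, A ^ 2 :=
    Finset.sum_le_sum fun i _ => pow_le_pow_left₀ (abs_nonneg _) (h i) 2
  rw [Finset.sum_const, Finset.card_univ, Fintype.card_fin, nsmul_eq_mul] at h1
  calc _ ≤ 1 / (n : ℝ) * (n * A ^ 2) := by gcongr
    _ = A ^ 2 := by field_simp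

lemma polyEmpNorm_eq_of_abs_eq {n : ℕ} (hn : 0 < n) {x : Fin n → ℝ} {p : ℝ[X]} {A : ℝ}
    (hA : 0 ≤ A) (h : ∀ i, |p.eval (x i)| = A) : polyEmpNorm x p = A := by
  have hn' : (0 : ℝ) < n := by exact_mod_cast hn
  rw [polyEmpNorm, Finset.sum_congr rfl fun i _ => by rw [h i], Finset.sum_const,
    Finset.card_univ, Fintype.card_fin, nsmul_eq_mul, ← mul_assoc, one_div_mul_cancel hn'.ne',
    one_mul, Real.sqrt_sq hA]

lemma eval_eq_zero_of_polyEmpNorm_eq_zero {n : ℕ} (hn : 0 < n) {x : Fin n → ℝ} {p : ℝ[X]}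
    (h : polyEmpNorm x p = 0) (i : Fin n) : p.eval (x i) = 0 := by
  have hn' : (0 : ℝ) < n := by exact_mod_cast hn
  rw [polyEmpNorm, Real.sqrt_eq_zero (by positivity)] at h
  have h2 : ∑ i, |p.eval (x i)| ^ 2 = 0 := by
    rcases mul_eq_zero.1 h with h | h
    · exact absurd h (by positivity)
    · exact h
  have h3 := (Finset.sum_eq_zero_iff_of_nonneg fun i _ => by positivity).1 h2 i (Finset.mem_univ _)
  simpa using h3

lemma ofReal_div_polyEmpNorm_le_Dnm {α β : ℝ} {n m : ℕ} {x : Fin n → ℝ} {p : ℝ[X]}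
    (hp : p.natDegree ≤ m) (h : polyEmpNorm x p ≠ 0) :
    ENNReal.ofReal (polyL2Norm α β p / polyEmpNorm x p) ≤ Dnm α β m x := by
  unfold Dnm
  exact le_iSup_of_le p (le_iSup_of_le (mem_degreeLE.2 (natDegree_le_iff_degree_le.1 hp))
    (le_iSup_of_le h le_rfl))

/-- `‖p + s‖² = ‖p‖² + 2 s ∫ p + s²`, so `s` takes the sign of `∫ p`. -/
lemma exists_add_const_polyL2Norm_le {α β : ℝ} [IsProbabilityMeasure (jacobiMeasure α β)]
    (p : ℝ[X]) {A : ℝ} (hA : 0 ≤ A) :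
    ∃ s : ℝ, |s| = A ∧ polyL2Norm α β p ≤ polyL2Norm α β (p + C s) := by
  have key : ∀ s : ℝ, 0 ≤ s * ∫ x, p.eval x ∂(jacobiMeasure α β) →
      polyL2Norm α β p ≤ polyL2Norm α β (p + C s) := by
    intro s hs
    refine Real.sqrt_le_sqrt ?_
    have e : ∀ x, |(p + C s).eval x| ^ 2 = |p.eval x| ^ 2 + (2 * s * p.eval x + s ^ 2) := by
      intro x; rw [sq_abs, sq_abs, eval_add, eval_C]; ring
    simp_rw [e]
    rw [integral_add (integrable_jacobiMeasure_of_continuous (by fun_prop))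
      (integrable_jacobiMeasure_of_continuous (by fun_prop)),
      integral_add (integrable_jacobiMeasure_of_continuous (by fun_prop)) (integrable_const _),
      integral_const_mul]
    simp only [integral_const, probReal_univ, one_smul]
    nlinarith [sq_nonneg s]
  rcases le_total 0 (∫ x, p.eval x ∂(jacobiMeasure α β)) with h | h
  · exact ⟨A, abs_of_nonneg hA, key A (mul_nonneg hA h)⟩
  · exact ⟨-A, by rw [abs_neg, abs_of_nonneg hA], key (-A) (by nlinarith)⟩

/-- If `p` vanishes at every sample, the supremum excludes it; adding a constant of modulus `A`
gives an admissible polynomial with no smaller `L²` norm. -/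
lemma ofReal_div_le_Dnm {α β : ℝ} [IsProbabilityMeasure (jacobiMeasure α β)] {n m : ℕ}
    (hn : 0 < n) {x : Fin n → ℝ} {p : ℝ[X]} {A B : ℝ} (hp : p.natDegree ≤ m) (hA : 0 < A)
    (hx : ∀ i, |p.eval (x i)| ≤ A) (hB0 : 0 ≤ B) (hB : B ≤ polyL2Norm α β p) :
    ENNReal.ofReal (B / A) ≤ Dnm α β m x := by
  by_cases h : polyEmpNorm x p = 0
  · obtain ⟨s, hs, hps⟩ := exists_add_const_polyL2Norm_le (α := α) (β := β) p hA.le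
    have he : polyEmpNorm x (p + C s) = A :=
      polyEmpNorm_eq_of_abs_eq hn hA.le fun i => by
        rw [eval_add, eval_C, eval_eq_zero_of_polyEmpNorm_eq_zero hn h i, zero_add, hs]
    refine le_trans (ENNReal.ofReal_le_ofReal ?_)
      (ofReal_div_polyEmpNorm_le_Dnm (natDegree_add_C.le.trans hp) (he ▸ hA.ne'))
    rw [he]
    gcongr
    exact hB.trans hps
  · refine le_trans (ENNReal.ofReal_le_ofReal ?_) (ofReal_div_polyEmpNorm_le_Dnm hp h)
    have hpos : 0 < polyEmpNorm x p := (Real.sqrt_nonneg _).lt_of_ne' h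
    exact div_le_div₀ (hB0.trans hB) hB hpos (polyEmpNorm_le hn hA.le hx)

lemma one_le_Dnm {α β : ℝ} [IsProbabilityMeasure (jacobiMeasure α β)] {n : ℕ} (m : ℕ)
    (hn : 0 < n) (x : Fin n → ℝ) : 1 ≤ Dnm α β m x := by
  have := ofReal_div_le_Dnm (α := α) (β := β) (m := m) hn (x := x) (p := 1) (A := 1) (B := 1)
    (by simp) one_pos (by simp) zero_le_one (by simp [polyL2Norm])
  simpa using this

/-! ### Reflection -/

lemma jacobiConst_comm (α β : ℝ) : jacobiConst β α = jacobiConst α β := by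
  unfold jacobiConst
  have h := intervalIntegral.integral_comp_neg (a := -1) (b := 1)
    fun x : ℝ => (1 - x) ^ α * (1 + x) ^ β
  rw [neg_neg] at h
  rw [← h]
  congr 1
  refine intervalIntegral.integral_congr fun x _ => ?_
  simp only [sub_neg_eq_add, ← sub_eq_add_neg]
  ring

lemma jacobiWeight_neg (α β x : ℝ) : jacobiWeight β α (-x) = jacobiWeight α β x := by
  simp only [jacobiWeight, jacobiConst_comm α β, sub_neg_eq_add, ← sub_eq_add_neg]
  ring

lemma jacobiCbar_comm (α β : ℝ) : jacobiCbar β α = jacobiCbar α β := by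
  simp only [jacobiCbar, jacobiConst_comm α β, min_comm β, max_comm β]

lemma map_neg_jacobiMeasure (α β : ℝ) :
    (jacobiMeasure α β).map (fun x => -x) = jacobiMeasure β α := by
  ext s hs
  rw [Measure.map_apply measurable_neg hs, jacobiMeasure, jacobiMeasure,
    withDensity_apply _ (measurable_neg hs), withDensity_apply _ hs,
    Measure.restrict_restrict hs, Measure.restrict_restrict (measurable_neg hs)]
  have h := (Measure.measurePreserving_neg (volume : Measure ℝ)).setLIntegral_comp_preimage
    (hs.inter measurableSet_Icc) (f := fun x => ENNReal.ofReal (jacobiWeight β α x))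
    (measurable_jacobiWeight β α).ennreal_ofReal (s := s ∩ Set.Icc (-1) 1)
  simp only [jacobiWeight_neg] at h
  rw [← h]
  congr 2
  ext x
  simp only [Set.mem_inter_iff, Set.mem_preimage, Set.mem_Icc]
  constructor <;> rintro ⟨a, b, c⟩ <;> exact ⟨a, by linarith, by linarith⟩

lemma Dnm_neg_le (α β : ℝ) {n : ℕ} (m : ℕ) (x : Fin n → ℝ) :
    Dnm β α m (fun i => -x i) ≤ Dnm α β m x := by
  conv_lhs => unfold Dnm
  refine iSup_le fun p => iSup_le fun hp => iSup_le fun h => ?_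
  have hev : ∀ y, (p.comp (-X)).eval y = p.eval (-y) := by simp
  have h1 : polyEmpNorm x (p.comp (-X)) = polyEmpNorm (fun i => -x i) p := by
    simp only [polyEmpNorm, hev]
  have h2 : polyL2Norm α β (p.comp (-X)) = polyL2Norm β α p := by
    rw [polyL2Norm, polyL2Norm, ← map_neg_jacobiMeasure α β,
      integral_map measurable_neg.aemeasurable (Continuous.aestronglyMeasurable (by fun_prop))]
    simp only [hev]
  rw [← h1, ← h2]
  refine ofReal_div_polyEmpNorm_le_Dnm ?_ (h1 ▸ h)
  refine natDegree_comp_le.trans ?_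
  rw [natDegree_neg, natDegree_X, mul_one]
  exact natDegree_le_iff_degree_le.2 (mem_degreeLE.1 hp)

/-! ### Few sample points near the endpoint -/

/-- Markov's inequality for the number of samples in `[a, ∞)`. -/
lemma measure_card_filter_ge_le {Ω : Type*} [MeasurableSpace Ω] {P : Measure Ω} {n : ℕ}
    {x : Fin n → Ω → ℝ} {μ : Measure ℝ} (hx : ∀ i, HasLaw (x i) μ P) {a r t : ℝ} (ht : 0 < t)
    (hμ : μ (Set.Ici a) ≤ ENNReal.ofReal r) :
    P {ω | t ≤ ((Finset.univ.filter fun i => a ≤ x i ω).card : ℝ)} ≤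
      ENNReal.ofReal (n * r / t) := by
  have hm : ∀ i, AEMeasurable (fun ω => (Set.Ici a).indicator (1 : ℝ → ℝ≥0∞) (x i ω)) P := fun i =>
    (measurable_one.indicator measurableSet_Ici).comp_aemeasurable (hx i).aemeasurable
  have hsum : ∀ ω, ∑ i, (Set.Ici a).indicator (1 : ℝ → ℝ≥0∞) (x i ω) =
      ENNReal.ofReal ((Finset.univ.filter fun i => a ≤ x i ω).card : ℝ) := by
    intro ω
    simp [Set.indicator_apply]
  have hmarkov := meas_ge_le_lintegral_div
    (f := fun ω => ∑ i, (Set.Ici a).indicator (1 : ℝ → ℝ≥0∞) (x i ω)) (μ := P)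
    (Finset.aemeasurable_fun_sum _ fun i _ => hm i) (ε := ENNReal.ofReal t) (by simpa) (by simp)
  have hint : ∫⁻ ω, ∑ i, (Set.Ici a).indicator (1 : ℝ → ℝ≥0∞) (x i ω) ∂P ≤
      ENNReal.ofReal (n * r) := by
    rw [lintegral_finsetSum' _ fun i _ => hm i]
    refine (Finset.sum_le_card_nsmul _ _ (ENNReal.ofReal r) fun i _ => ?_).trans ?_
    · have h1 := lintegral_map' (μ := P) (f := (Set.Ici a).indicator (1 : ℝ → ℝ≥0∞))
        (measurable_one.indicator measurableSet_Ici).aemeasurable (hx i).aemeasurable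
      rw [← h1, (hx i).map_eq, lintegral_indicator_one measurableSet_Ici]
      exact hμ
    · rw [Finset.card_univ, Fintype.card_fin, nsmul_eq_mul, ENNReal.ofReal_mul (by positivity)]
      simp
  calc _ ≤ P {ω | ENNReal.ofReal t ≤ ∑ i, (Set.Ici a).indicator (1 : ℝ → ℝ≥0∞) (x i ω)} := by
        refine measure_mono fun ω hω => ?_
        rw [Set.mem_ofPred_eq, hsum]
        exact ENNReal.ofReal_le_ofReal hω
    _ ≤ _ := hmarkov
    _ ≤ ENNReal.ofReal (n * r) / ENNReal.ofReal t := by gcongr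
    _ = _ := (ENNReal.ofReal_div_of_pos ht).symm

/-! ### The lower bound for samples with few points near `1` -/

lemma ofReal_exp_le_Dnm {α β u : ℝ} (hα : -1 < α) (hβ : -1 < β)
    [IsProbabilityMeasure (jacobiMeasure α β)] {n m : ℕ} (hn : 0 < n) {x : Fin n → ℝ}
    (hx : ∀ i, x i ∈ Set.Icc (-1 : ℝ) 1) (hu : 1 ≤ u) (hum : 120 * u ≤ m)
    (hcard : ((Finset.univ.filter fun i => 1 - (120 * u / m) ^ 2 ≤ x i).card : ℝ) < u) :
    ENNReal.ofReal (Real.sqrt (jacobiConst α β / 2) * (m : ℝ) ^ (-(α + 2)) * Real.exp u) ≤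
      Dnm α β m x := by
  have hm : (0 : ℝ) < m := by linarith
  have hc := jacobiConst_nonneg α β
  set h : ℝ := (120 * u / m) ^ 2 with hh
  have h0 : 0 < h := by positivity
  have h1 : h ≤ 1 := pow_le_one₀ (by positivity) ((div_le_one hm).2 hum)
  set K := ⌊u⌋₊ with hKdef
  have hKu : (K : ℝ) ≤ u := Nat.floor_le (by linarith)
  have huK : u < K + 1 := Nat.lt_floor_add_one u
  have hK1 : 1 ≤ K := Nat.le_floor (by simpa using hu)
  have hK1' : (1 : ℝ) ≤ K := by exact_mod_cast hK1
  set S := Finset.univ.filter fun i => 1 - h ≤ x i with hS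
  have hSK : S.card ≤ K := Nat.le_floor hcard.le
  have hSK' : (S.card : ℝ) ≤ K := by exact_mod_cast hSK
  -- The largest `d` with `15 K d ≤ m`. As `K ≤ u < 2 K` and rounding loses at most a factor `2`, `d
  -- * √h` lies in `[4, 16]`.
  set d := m / (15 * K) with hd
  have hdm : 15 * K * d ≤ m := Nat.mul_div_le m (15 * K)
  have hmd : m < 15 * K * (d + 1) := Nat.lt_mul_div_succ m (by positivity)
  have hdm' : 15 * (K : ℝ) * d ≤ m := by exact_mod_cast hdm
  have hmd' : (m : ℝ) < 15 * K * (d + 1) := by exact_mod_cast hmd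
  have hd1 : (1 : ℝ) ≤ d := by
    have : 0 < d := Nat.div_pos (by
      have : (15 * K : ℝ) ≤ m := by linarith
      exact_mod_cast this) (by positivity)
    exact_mod_cast this
  have hdu : 4 ≤ (d : ℝ) * (120 * u / m) := by
    rw [mul_div_assoc', le_div_iff₀ hm]
    nlinarith
  have hdu' : (d : ℝ) * (120 * u / m) ≤ 16 := by
    rw [mul_div_assoc', div_le_iff₀ hm]
    nlinarith
  obtain ⟨p, hpdeg, hpx, hpI⟩ := exists_polynomial_small_on_sample_large_near_one x hx h0 d K
    (by rw [hh, ← mul_pow]; nlinarith) (by rw [hh, ← mul_pow]; nlinarith) hSK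
  set W := jacobiConst α β / 2 * (h / 4) ^ (α + 1) with hW
  have hW0 : 0 ≤ W := by positivity
  have hint := const_mul_integral_le_integral_jacobiMeasure (α := α) (β := β) h0 h1 hW0
    (fun y hy => jacobiWeight_ge hα hβ h0 h1 hy) (f := fun y => p.eval y ^ 2) (by fun_prop)
    fun y => sq_nonneg _
  have hhm : ((m : ℝ) ^ (-(α + 2))) ^ 2 ≤ (h / 4) ^ (α + 2) := by
    have e : ((m : ℝ) ^ (-(α + 2))) ^ 2 = ((m : ℝ)⁻¹ ^ 2) ^ (α + 2) := by
      rw [← Real.rpow_natCast, ← Real.rpow_natCast, ← Real.rpow_mul hm.le,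
        ← Real.rpow_mul (by positivity), mul_comm (-(α + 2)), mul_neg, Real.rpow_neg hm.le,
        Real.inv_rpow hm.le]
    rw [e]
    refine Real.rpow_le_rpow (by positivity) ?_ (by linarith)
    rw [hh, div_eq_mul_inv (120 * u), mul_pow]
    have h2 : 4 ≤ (120 * u) ^ 2 := by nlinarith
    have h3 := mul_le_mul_of_nonneg_right h2 (sq_nonneg (m : ℝ)⁻¹)
    linarith
  have hL2 : Real.sqrt (jacobiConst α β / 2) * (m : ℝ) ^ (-(α + 2)) *
      Real.exp (28 * K - S.card) ≤ polyL2Norm α β p := by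
    refine Real.le_sqrt_of_sq_le ?_
    simp only [sq_abs]
    refine le_trans ?_ hint
    refine le_trans ?_ (mul_le_mul_of_nonneg_left hpI hW0)
    have e1 : Real.exp (28 * K - S.card) ^ 2 = Real.exp (56 * K - 2 * S.card) := by
      rw [← Real.exp_nat_mul]; push_cast; ring_nf
    have e2 : (h / 4) ^ (α + 1) * (h / 4) = (h / 4) ^ (α + 2) := by
      rw [← Real.rpow_add_one (by positivity)]; ring_nf
    rw [mul_pow, mul_pow, Real.sq_sqrt (by positivity), e1, hW, ← mul_assoc, mul_assoc _ _ (h / 4),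
      e2]
    gcongr
  refine le_trans (ENNReal.ofReal_le_ofReal ?_) (ofReal_div_le_Dnm hn (hpdeg.trans hdm)
    (Real.exp_pos _) hpx (by positivity) hL2)
  -- The exponent is `28 K - 25 #S ≥ 3 K ≥ K + 1 > u`.
  rw [mul_div_assoc, ← Real.exp_sub]
  gcongr
  linarith

/-! ### Choice of the exponents -/

/-- The first condition controls the Markov bound; the second gives `120 u ≤ m`, hence `h ≤ 1`. Only
`γ` and `C₀` enter, so `ν = e ^ (κ / 5)` is uniform in `C`. -/
lemma exists_rate_constant {γ : ℝ} (hγ : -1 / 2 < γ) {C₀ : ℝ} (hC₀ : 0 < C₀) :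
    ∃ κ : ℝ, 0 < κ ∧ (120 : ℝ) ^ (2 * (1 + γ)) * κ ^ (1 + 2 * γ) ≤ 1 ∧
      120 * κ ≤ C₀ ^ (1 / (1 + 2 * γ)) := by
  have hg : 0 < 1 + 2 * γ := by linarith
  refine ⟨min ((120 : ℝ) ^ (-(2 * (1 + γ)) / (1 + 2 * γ))) (C₀ ^ (1 / (1 + 2 * γ)) / 120),
    by positivity, ?_, ?_⟩
  · calc _ ≤ (120 : ℝ) ^ (2 * (1 + γ)) *
          ((120 : ℝ) ^ (-(2 * (1 + γ)) / (1 + 2 * γ))) ^ (1 + 2 * γ) := by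
          gcongr
          exact min_le_left _ _
      _ = 1 := by
          rw [← Real.rpow_mul (by norm_num), div_mul_cancel₀ _ hg.ne',
            ← Real.rpow_add (by norm_num), add_neg_cancel, Real.rpow_zero]
  · have := min_le_right ((120 : ℝ) ^ (-(2 * (1 + γ)) / (1 + 2 * γ)))
      (C₀ ^ (1 / (1 + 2 * γ)) / 120)
    linarith

lemma rateExponent_nonneg {γ C : ℝ} (hC : 0 ≤ C) (n m : ℕ) : 0 ≤ rateExponent γ C n m := by
  unfold rateExponent
  positivity

lemma rateExponent_rpow {γ C : ℝ} (hγ : -1 / 2 < γ) (hC : 0 ≤ C) (n m : ℕ) :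
    rateExponent γ C n m ^ (1 + 2 * γ) = (m : ℝ) ^ (2 * (1 + γ)) / (C * n) := by
  have hg : 0 < 1 + 2 * γ := by linarith
  rw [rateExponent, ← Real.rpow_mul (by positivity), one_div_mul_cancel hg.ne', Real.rpow_one]

lemma mul_rateExponent_le {γ C₀ C : ℝ} (hγ : -1 / 2 < γ) (hC₀ : 0 < C₀) (hC : C₀ ≤ C) {n m : ℕ}
    (hm : 0 < m) (hmn : m < n) : C₀ ^ (1 / (1 + 2 * γ)) * rateExponent γ C n m ≤ m := by
  have hg : 0 < 1 + 2 * γ := by linarith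
  have hm' : (0 : ℝ) < m := by exact_mod_cast hm
  have hmn' : (m : ℝ) ≤ n := by exact_mod_cast hmn.le
  have hn' : (0 : ℝ) < n := by linarith
  have hC' : 0 < C := by linarith
  rw [rateExponent, ← Real.mul_rpow hC₀.le (by positivity)]
  have e : (m : ℝ) = ((m : ℝ) ^ (1 + 2 * γ)) ^ (1 / (1 + 2 * γ)) := by
    rw [← Real.rpow_mul hm'.le, mul_one_div_cancel hg.ne', Real.rpow_one]
  conv_rhs => rw [e]
  refine Real.rpow_le_rpow (by positivity) ?_ (by positivity)
  have e2 : (m : ℝ) ^ (2 * (1 + γ)) = (m : ℝ) ^ (1 + 2 * γ) * m := by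
    rw [← Real.rpow_add_one hm'.ne']; ring_nf
  rw [e2, mul_div_assoc', div_le_iff₀ (by positivity)]
  calc C₀ * ((m : ℝ) ^ (1 + 2 * γ) * m) ≤ C * ((m : ℝ) ^ (1 + 2 * γ) * n) := by gcongr
    _ = _ := by ring

/-- `h ^ (1 + γ) / u` is a multiple of `u ^ (1 + 2γ)`, and `λ ^ (1 + 2γ) = m ^ (2 (1 + γ)) / (C n)`
cancels both `m` and `n`. The factor `e ^ 2` is slack. -/
lemma expected_count_div_le {γ C κ b : ℝ} (hγ : -1 / 2 < γ) (hC : 0 < C) (hκ : 0 < κ) (hb : 0 ≤ b)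
    (hκ1 : (120 : ℝ) ^ (2 * (1 + γ)) * κ ^ (1 + 2 * γ) ≤ 1) {n m : ℕ} (hm : 0 < m) (hn : 0 < n) :
    n * (2 * b * ((120 * (κ * rateExponent γ C n m) / m) ^ 2) ^ (1 + γ)) /
      (κ * rateExponent γ C n m) ≤ 2 * Real.exp 1 ^ 2 * b / C := by
  have hm' : (0 : ℝ) < m := by exact_mod_cast hm
  have hn' : (0 : ℝ) < n := by exact_mod_cast hn
  set l := rateExponent γ C n m with hl
  have hl0 : 0 < l := by rw [hl, rateExponent]; positivity
  have h1 : ((120 * (κ * l) / m) ^ 2) ^ (1 + γ) =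
      (120 : ℝ) ^ (2 * (1 + γ)) * (κ ^ (1 + 2 * γ) * l ^ (1 + 2 * γ)) * (κ * l) /
        (m : ℝ) ^ (2 * (1 + γ)) := by
    rw [← Real.rpow_natCast, ← Real.rpow_mul (by positivity), Real.div_rpow (by positivity) hm'.le,
      Real.mul_rpow (by norm_num) (by positivity), ← Real.mul_rpow hκ.le hl0.le, mul_assoc,
      ← Real.rpow_add_one (by positivity)]
    push_cast
    ring_nf
  rw [h1, rateExponent_rpow hγ hC.le]
  have he : (1 : ℝ) ≤ Real.exp 1 ^ 2 := one_le_pow₀ (Real.one_le_exp zero_le_one)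
  have hmp : 0 < (m : ℝ) ^ (2 * (1 + γ)) := by positivity
  calc _ = (120 : ℝ) ^ (2 * (1 + γ)) * κ ^ (1 + 2 * γ) * (2 * b / C) := by field_simp
    _ ≤ 1 * (2 * b / C) := by gcongr
    _ ≤ Real.exp 1 ^ 2 * (2 * b / C) := by gcongr
    _ = _ := by ring

/-- As `1 + γ > 1 / 2`, the hypothesis gives `m ^ 2 ≤ e ^ (4 u / 5)`: one factor `m` offsets `m⁻¹`,
the other offsets `√(c / 2)`. With `m ≥ 3`, `9 ≤ e ^ (4 u / 5)` forces `u ≥ 1`. -/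
lemma one_le_and_le_of_rpow_lt_exp {γ c u : ℝ} (hγ : -1 / 2 < γ) (hc : 0 < c) {m : ℕ}
    (hm : 3 ≤ m) (hmc : Real.sqrt (2 / c) ≤ m) (hu : (m : ℝ) ^ (1 + γ) < Real.exp (u / 5)) :
    1 ≤ u ∧ 1 / (m : ℝ) ^ (1 + γ) * Real.exp (u / 5) ≤
      Real.sqrt (c / 2) * (m : ℝ) ^ (-(γ + 2)) * Real.exp u := by
  have hm3 : (3 : ℝ) ≤ m := by exact_mod_cast hm
  have hm0 : (0 : ℝ) < m := by linarith
  have h1 : (m : ℝ) ^ (1 / 2 : ℝ) ≤ Real.exp (u / 5) :=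
    (Real.rpow_le_rpow_of_exponent_le (by linarith) (by linarith)).trans hu.le
  have h4 : (m : ℝ) ^ 2 ≤ Real.exp (4 * (u / 5)) := by
    calc (m : ℝ) ^ 2 = ((m : ℝ) ^ (1 / 2 : ℝ)) ^ 4 := by
          rw [← Real.rpow_natCast, ← Real.rpow_natCast, ← Real.rpow_mul hm0.le]; norm_num
      _ ≤ Real.exp (u / 5) ^ 4 := by gcongr
      _ = _ := by rw [← Real.exp_nat_mul]; norm_num
  refine ⟨?_, ?_⟩
  · by_contra! hlt
    have h5 : Real.exp (4 * (u / 5)) ≤ Real.exp 1 := Real.exp_le_exp.2 (by linarith)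
    have := Real.exp_one_lt_d9
    nlinarith
  · have hs : Real.sqrt (2 / c) * Real.sqrt (c / 2) = 1 := by
      rw [← Real.sqrt_mul (by positivity), div_mul_div_cancel₀ hc.ne']; norm_num
    have hs0 : 0 < Real.sqrt (c / 2) := by positivity
    have e1 : (m : ℝ) ^ (-(γ + 2)) = 1 / (m : ℝ) ^ (1 + γ) * (m : ℝ)⁻¹ := by
      rw [Real.rpow_neg hm0.le, one_div, ← mul_inv, ← Real.rpow_add_one hm0.ne']; ring_nf
    have e2 : Real.exp u = Real.exp (u / 5) * Real.exp (4 * (u / 5)) := by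
      rw [← Real.exp_add]; ring_nf
    rw [e1, e2]
    have h6 : 1 ≤ Real.sqrt (c / 2) * (m : ℝ)⁻¹ * Real.exp (4 * (u / 5)) :=
      calc 1 = Real.sqrt (2 / c) * Real.sqrt (c / 2) := hs.symm
        _ ≤ m * Real.sqrt (c / 2) := by gcongr
        _ = Real.sqrt (c / 2) * (m : ℝ)⁻¹ * (m : ℝ) ^ 2 := by field_simp
        _ ≤ _ := by gcongr
    have h7 : 0 ≤ 1 / (m : ℝ) ^ (1 + γ) * Real.exp (u / 5) := by positivity
    calc _ ≤ 1 / (m : ℝ) ^ (1 + γ) * Real.exp (u / 5) *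
          (Real.sqrt (c / 2) * (m : ℝ)⁻¹ * Real.exp (4 * (u / 5))) := le_mul_of_one_le_right h7 h6
      _ = _ := by ring

/-! ### The probabilistic lower bound -/

lemma ofReal_one_sub_le_measure {Ω : Type*} [MeasurableSpace Ω] {P : Measure Ω}
    [IsProbabilityMeasure P] {E : Set Ω} {δ : ℝ} (hδ : 0 ≤ δ) (h : P Eᶜ ≤ ENNReal.ofReal δ) :
    ENNReal.ofReal (1 - δ) ≤ P E := by
  rw [ENNReal.ofReal_sub _ hδ, ENNReal.ofReal_one, tsub_le_iff_right]
  calc (1 : ℝ≥0∞) = P (E ∪ Eᶜ) := by rw [Set.union_compl_self, measure_univ]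
    _ ≤ P E + P Eᶜ := measure_union_le _ _
    _ ≤ _ := by gcongr

lemma measure_Dnm_ge_of_le {γ β C₀ C κ : ℝ} (hγ : -1 / 2 < γ) (hβ : -1 < β) (hβγ : β ≤ γ)
    (hC₀ : 0 < C₀) (hC : C₀ ≤ C) (hκ : 0 < κ)
    (hκ1 : (120 : ℝ) ^ (2 * (1 + γ)) * κ ^ (1 + 2 * γ) ≤ 1)
    (hκ2 : 120 * κ ≤ C₀ ^ (1 / (1 + 2 * γ))) {m n : ℕ} (hm : 3 ≤ m)
    (hmc : Real.sqrt (2 / jacobiConst γ β) ≤ m) (hmn : m < n) {Ω : Type*} [MeasurableSpace Ω]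
    {P : Measure Ω} [IsProbabilityMeasure P] {x : Fin n → Ω → ℝ}
    (hx : ∀ i, HasLaw (x i) (jacobiMeasure γ β) P) :
    ENNReal.ofReal (1 - 2 * Real.exp 1 ^ 2 * jacobiCbar γ β / C) ≤
      P {ω | ENNReal.ofReal (1 / (m : ℝ) ^ (1 + γ) * Real.exp (κ / 5) ^ rateExponent γ C n m) ≤
        Dnm γ β m (fun i => x i ω)} := by
  have hn : 0 < n := by omega
  have hm0 : 0 < m := by omega
  have hm' : (0 : ℝ) < m := by exact_mod_cast hm0
  have hC' : 0 < C := by linarith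
  have hprob : IsProbabilityMeasure (jacobiMeasure γ β) :=
    (hx ⟨0, hn⟩).isProbabilityMeasure_iff.1 inferInstance
  have hc := jacobiConst_pos_of_isProbabilityMeasure hprob
  have hcbar : 0 ≤ jacobiCbar γ β := by
    rw [jacobiCbar, max_eq_left hβγ]
    have : 0 < 1 + γ := by linarith
    positivity
  set u := κ * rateExponent γ C n m with hu
  have hν : Real.exp (κ / 5) ^ rateExponent γ C n m = Real.exp (u / 5) := by
    rw [← Real.exp_mul, hu]; ring_nf
  rw [hν]
  refine ofReal_one_sub_le_measure (by positivity) ?_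
  rcases le_or_gt (Real.exp (u / 5)) ((m : ℝ) ^ (1 + γ)) with htriv | hbig
  · refine le_of_eq_of_le ?_ zero_le
    convert measure_empty (μ := P)
    rw [Set.compl_empty_iff, Set.eq_univ_iff_forall]
    intro ω
    refine le_trans ?_ (one_le_Dnm m hn _)
    rw [ENNReal.ofReal_le_one, one_div_mul_eq_div]
    exact (div_le_one (by positivity)).2 htriv
  · obtain ⟨hu1, hlow⟩ := one_le_and_le_of_rpow_lt_exp hγ hc hm hmc hbig
    have hum : 120 * u ≤ m := by
      have h1 := mul_rateExponent_le hγ hC₀ hC hm0 hmn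
      have h2 := mul_le_mul_of_nonneg_right hκ2 (rateExponent_nonneg (γ := γ) hC'.le n m)
      linarith
    set h : ℝ := (120 * u / m) ^ 2 with hh
    have h0 : 0 < h := by positivity
    have h1 : h ≤ 1 := pow_le_one₀ (by positivity) ((div_le_one hm').2 hum)
    have hcount := measure_card_filter_ge_le hx (t := u) (by linarith)
      (jacobiMeasure_Ici_le (by linarith) hβ hβγ h0 h1)
    have hae : ∀ᵐ ω ∂P, ∀ i, x i ω ∈ Set.Icc (-1 : ℝ) 1 := by
      refine ae_all_iff.2 fun i => ?_
      have := ae_mem_Icc_jacobiMeasure γ β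
      rw [← (hx i).map_eq] at this
      exact ae_of_ae_map (hx i).aemeasurable this
    calc _ ≤ P {ω | u ≤ ((Finset.univ.filter fun i => 1 - h ≤ x i ω).card : ℝ)} := by
          -- Samples lie in `[-1, 1]` only almost surely.
          refine measure_mono_ae ?_
          filter_upwards [hae] with ω hω hnot
          by_contra hcard
          exact hnot ((ENNReal.ofReal_le_ofReal hlow).trans
            (ofReal_exp_le_Dnm (by linarith) hβ hn hω hu1 hum (not_le.1 hcard)))
      _ ≤ _ := hcount
      _ ≤ _ := ENNReal.ofReal_le_ofReal (expected_count_div_le hγ hC' hκ hcbar hκ1 hm0 hn)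

theorem corollary3p2 (γ : ℝ) (hγ : -1 / 2 < γ) (C₀ : ℝ) (hC₀ : 0 < C₀) :
    ∃ η ν : ℝ, 0 < η ∧ 1 < ν ∧
      ∀ α β : ℝ, -1 < α → -1 < β → max α β = γ →
        ∃ M : ℕ, ∀ C : ℝ, C₀ ≤ C → 2 * Real.exp 1 ^ 2 * jacobiCbar α β < C →
          ∀ m n : ℕ, M ≤ m → m < n →
            ∀ (Ω : Type*) [MeasurableSpace Ω] (P : Measure Ω) [IsProbabilityMeasure P]
              (x : Fin n → Ω → ℝ),
              (∀ i, HasLaw (x i) (jacobiMeasure α β) P) → iIndepFun x P →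
                ENNReal.ofReal (1 - 2 * Real.exp 1 ^ 2 * jacobiCbar α β / C) ≤
                  P {ω | ENNReal.ofReal (η / (m : ℝ) ^ (1 + γ) * ν ^ rateExponent γ C n m) ≤
                    Dnm α β m (fun i => x i ω)} := by
  obtain ⟨κ, hκ, hκ1, hκ2⟩ := exists_rate_constant hγ hC₀
  refine ⟨1, Real.exp (κ / 5), one_pos, Real.one_lt_exp_iff.2 (by positivity), ?_⟩
  intro α β hα hβ hmax
  -- `m ≥ 3` yields `u ≥ 1` in the nontrivial case, and `m ≥ √(2 / c)` absorbs the normalizing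
  -- constant; neither depends on `C`.
  refine ⟨max 3 ⌈Real.sqrt (2 / jacobiConst α β)⌉₊, fun C hC _ m n hM hmn Ω _ P _ x hx _ => ?_⟩
  have hm3 : 3 ≤ m := (le_max_left _ _).trans hM
  have hmc : Real.sqrt (2 / jacobiConst α β) ≤ m :=
    (Nat.le_ceil _).trans (by exact_mod_cast (le_max_right _ _).trans hM)
  rcases le_total β α with hle | hle
  · rw [max_eq_left hle] at hmax
    subst hmax
    exact measure_Dnm_ge_of_le hγ hβ hle hC₀ hC hκ hκ1 hκ2 hm3 hmc hmn hx
  · rw [max_eq_right hle] at hmax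
    subst hmax
    have hx' : ∀ i, HasLaw (fun ω => -x i ω) (jacobiMeasure β α) P := fun i =>
      (⟨measurable_neg.aemeasurable, map_neg_jacobiMeasure α β⟩ :
        HasLaw (fun y : ℝ => -y) (jacobiMeasure β α) (jacobiMeasure α β)).comp (hx i)
    rw [← jacobiConst_comm] at hmc
    rw [← jacobiCbar_comm]
    refine (measure_Dnm_ge_of_le hγ hα hle hC₀ hC hκ hκ1 hκ2 hm3 hmc hmn hx').trans ?_
    exact measure_mono fun ω hω => hω.trans (Dnm_neg_le α β m fun i => x i ω)
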